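/- Let $K$ be a field, let $n\ge 0$ be an integer, and call an ideal of $K[x_1,\dots,x_n]$ monomial if it is generated by monomials. For an ideal $I\subseteq K[x_1,\dots,x_n]$ let $\mathrm{Bl}_I(\mathbb{A}^n_K)=\operatorname{Proj}\bigl(\bigoplus_{d\ge 0} I^d\bigr)\to\mathbb{A}^n_K=\operatorname{Spec}K[x_1,\dots,x_n]$ be the blowup of affine space with center $I$. A monomial ideal $I$ is called tame if $\mathrm{Bl}_I(\mathbb{A}^n_K)$ is smooth over $K$. Let $I_1,\dots,I_k$ be monomial ideals in $K[x_1,\dots,x_n]$ and let $\alpha_1,\dots,\alpha_k$ be positive integers. Then $I_1\cdot\ldots\cdot I_k$ is tame if and only if $I_1^{\alpha_1}\cdot\ldots\cdot I_k^{\alpha_k}$ is tame. In particular, a monomial ideal $I$ is tame if and only if $I^2$ is tame. -/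

import Mathlib

noncomputable section

namespace TameMonomial

open AlgebraicGeometry CategoryTheory

universe u

/-- An ideal of a polynomial ring is monomial if it is generated by a set of monomials. -/
def IsMonomialIdeal {σ : Type*} {K : Type*} [CommSemiring K]
    (I : Ideal (MvPolynomial σ K)) : Prop :=
  ∃ A : Set (σ →₀ ℕ), I = Ideal.span ((fun a => MvPolynomial.monomial a (1 : K)) '' A)

section Blowup

variable {R : Type u} [CommRing R] (I : Ideal R)

/-- The homogeneous part of degree `d` of the Rees algebra `R[I t]`, which consists of the
elements `r t ^ d` (with `r ∈ I ^ d`). -/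
def reesGrading (d : ℕ) : Submodule R (reesAlgebra I) :=
  (LinearMap.range (Polynomial.monomial d : R →ₗ[R] Polynomial R)).comap
    (reesAlgebra I).val.toLinearMap

theorem mem_reesGrading_iff {d : ℕ} (f : reesAlgebra I) :
    f ∈ reesGrading I d ↔ ∃ r ∈ I ^ d, Polynomial.monomial d r = (f : Polynomial R) := by
  constructor
  · rintro ⟨r, hr⟩
    have hr' : Polynomial.monomial d r = (f : Polynomial R) := hr
    refine ⟨r, ?_, hr'⟩
    have := f.2
    rw [← hr'] at this
    exact reesAlgebra.monomial_mem.1 this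
  · rintro ⟨r, -, hr⟩
    exact ⟨r, hr⟩

instance reesGrading_gradedMonoid : SetLike.GradedMonoid (reesGrading I) where
  one_mem := ⟨1, rfl⟩
  mul_mem := by
    rintro i j f g ⟨r, hr⟩ ⟨s, hs⟩
    refine ⟨r * s, ?_⟩
    have hr' : Polynomial.monomial i r = (f : Polynomial R) := hr
    have hs' : Polynomial.monomial j s = (g : Polynomial R) := hs
    change Polynomial.monomial (i + j) (r * s) = (f : Polynomial R) * (g : Polynomial R)
    rw [← hr', ← hs', Polynomial.monomial_mul_monomial]

/-- The homogeneous component of degree `d` of an element of the Rees algebra. -/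
def reesComponent (f : reesAlgebra I) (d : ℕ) : reesGrading I d :=
  ⟨⟨Polynomial.monomial d ((f : Polynomial R).coeff d), reesAlgebra.monomial_mem.2 (f.2 d)⟩,
    ⟨_, rfl⟩⟩

instance reesGrading_decomposition : DirectSum.Decomposition (reesGrading I) where
  decompose' f := DFinsupp.mk (f : Polynomial R).support fun d => reesComponent I f d
  left_inv f := by
    classical
    rw [DirectSum.coeAddMonoidHom_eq_dfinsuppSum]
    refine Subtype.ext ?_
    rw [DFinsupp.sum, AddSubmonoidClass.coe_finsetSum]
    conv_rhs => rw [(f : Polynomial R).as_sum_support]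
    refine Finset.sum_subset_zero_on_sdiff (DFinsupp.support_mk_subset) ?_ ?_
    · intro d hd
      rw [Finset.mem_sdiff, DFinsupp.mem_support_iff, not_not] at hd
      have h := congrArg (fun z : reesGrading I d => ((z : reesAlgebra I) : Polynomial R)) hd.2
      simp only [DFinsupp.mk_apply, dif_pos hd.1] at h
      exact h
    · intro d hd
      have hd' := DFinsupp.support_mk_subset hd
      simp only [DFinsupp.mk_apply, dif_pos hd']
      rfl
  right_inv x := by
    classical
    refine DFinsupp.ext fun d => ?_
    have key : ∀ x : DirectSum ℕ (fun i => reesGrading I i),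
        ((x d : reesAlgebra I) : Polynomial R) = Polynomial.monomial d
          (((DirectSum.coeAddMonoidHom (reesGrading I) x : reesAlgebra I) :
            Polynomial R).coeff d) := by
      intro x
      induction x using DirectSum.induction_on with
      | zero => simp
      | of i y =>
        obtain ⟨f, r, hr⟩ := y
        have hr' : Polynomial.monomial i r = (f : Polynomial R) := hr
        rw [DirectSum.coeAddMonoidHom_of]
        by_cases h : i = d
        · subst h
          rw [DirectSum.of_eq_same]
          simp [← hr']
        · rw [DirectSum.of_eq_of_ne _ _ _ (Ne.symm h)]
          simp [← hr', Polynomial.coeff_monomial, h]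
      | add x y hx hy => simp [hx, hy, DirectSum.add_apply]
    refine Subtype.ext (Subtype.ext ?_)
    rw [key x, DFinsupp.mk_apply]
    split_ifs with h
    · rfl
    · rw [Polynomial.notMem_support_iff.1 h]
      simp

instance reesGrading_gradedAlgebra : GradedAlgebra (reesGrading I) where

/-- The blowup of `Spec R` with center the ideal `I`, i.e. `Proj` of the Rees algebra of `I`. -/
def blowup : Scheme.{u} := Proj (reesGrading I)

/-- The blowup map from the blowup of `Spec R` with center `I` to `Spec R`. -/
def blowupMap : blowup I ⟶ Spec (CommRingCat.of R) :=
  Proj.toSpecZero (reesGrading I) ≫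
    Spec.map (CommRingCat.ofHom (algebraMap R (reesGrading I 0)))

end Blowup

/-- An ideal `I` of `K[x_i : i ∈ σ]` is tame if the blowup of the affine space
`Spec K[x_i : i ∈ σ]` with center `I` is smooth over `K`. (We use this for monomial ideals.) -/
def IsTame {σ : Type} {K : Type u} [Field K] (I : Ideal (MvPolynomial σ K)) : Prop :=
  Smooth (blowupMap I ≫ Spec.map (CommRingCat.ofHom (algebraMap K (MvPolynomial σ K))))

end TameMonomial

end

/-! Replacing a factor `I` of the center by `I ^ 2` does not change the blowup. For `x ∈ J` and `y ∈
I`, the chart of `J * I` at `x * y` and that of `J * I ^ 2` at `x * y ^ 2` both embed into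
`R[1/(xy)]`, as the fractions `a / (xy)^n` with `a ∈ (JI)^n` and `b / (xy²)^n` with `b ∈ (JI²)^n`.
These subrings agree (`range_blowupChartToLocalization_mul_sq`), so the charts are isomorphic over
`R`. Both families of charts cover their blowups, and smoothness is local on the source
(`smooth_blowupMap_comp_iff`), so no gluing is needed. Arbitrary positive exponents follow by
induction, one factor at a time. -/

noncomputable section

namespace TameMonomial

open AlgebraicGeometry CategoryTheory HomogeneousLocalization

universe u

/-! ### Homogeneous elements of the Rees algebra -/

section Rees

variable {R : Type u} [CommRing R] (I : Ideal R)

/-- The element `a t ^ d` of the Rees algebra, where `a ∈ I ^ d`. -/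
def reesMonomial (d : ℕ) (a : R) (ha : a ∈ I ^ d) : reesAlgebra I :=
  ⟨Polynomial.monomial d a, reesAlgebra.monomial_mem.2 ha⟩

variable {I}

theorem reesMonomial_mem (d : ℕ) (a : R) (ha : a ∈ I ^ d) :
    reesMonomial I d a ha ∈ reesGrading I d :=
  ⟨a, rfl⟩

theorem exists_eq_reesMonomial {d : ℕ} {x : reesAlgebra I} (hx : x ∈ reesGrading I d) :
    ∃ a, ∃ ha : a ∈ I ^ d, x = reesMonomial I d a ha := by
  obtain ⟨a, ha, h⟩ := (mem_reesGrading_iff I x).1 hx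
  exact ⟨a, ha, Subtype.ext h.symm⟩

theorem reesMonomial_mul {d e : ℕ} {a b : R} (ha : a ∈ I ^ d) (hb : b ∈ I ^ e) :
    reesMonomial I d a ha * reesMonomial I e b hb =
      reesMonomial I (d + e) (a * b) (pow_add I d e ▸ Ideal.mul_mem_mul ha hb) :=
  Subtype.ext (Polynomial.monomial_mul_monomial ..)

theorem reesMonomial_add {d : ℕ} {a b : R} (ha : a ∈ I ^ d) (hb : b ∈ I ^ d) :
    reesMonomial I d (a + b) (add_mem ha hb) = reesMonomial I d a ha + reesMonomial I d b hb :=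
  Subtype.ext (map_add (Polynomial.monomial d) a b)

theorem reesMonomial_smul {d : ℕ} (r : R) {a : R} (ha : a ∈ I ^ d) :
    reesMonomial I d (r * a) (Ideal.mul_mem_left _ r ha) = r • reesMonomial I d a ha :=
  Subtype.ext (map_smul (Polynomial.monomial d) r a)

theorem reesMonomial_one_pow {a : R} (ha : a ∈ I ^ 1) (n : ℕ) :
    reesMonomial I 1 a ha ^ n =
      reesMonomial I n (a ^ n) (Ideal.pow_mem_pow (pow_one I ▸ ha) n) :=
  Subtype.ext (by simp [reesMonomial, Polynomial.monomial_pow])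

theorem reesMonomial_eq_zero_iff {d : ℕ} {a : R} {ha : a ∈ I ^ d} :
    reesMonomial I d a ha = 0 ↔ a = 0 := by
  rw [← Polynomial.monomial_eq_zero_iff a d]
  exact Subtype.ext_iff

theorem reesMonomial_one_mem_of_span {p : Ideal (reesAlgebra I)} {G : Set R}
    (hG : I = Ideal.span G) (h : ∀ g ∈ G, ∀ hg : g ∈ I ^ 1, reesMonomial I 1 g hg ∈ p) (a : R)
    (ha : a ∈ I ^ 1) : reesMonomial I 1 a ha ∈ p := by
  have ha' : a ∈ Ideal.span G := by rwa [← hG, ← pow_one I]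
  -- The membership proof is moved into the goal so that the induction can carry it along.
  suffices ∃ ha : a ∈ I ^ 1, reesMonomial I 1 a ha ∈ p from this.2
  clear ha
  induction ha' using Submodule.span_induction with
  | mem g hg =>
    have hgI : g ∈ I ^ 1 := by rw [pow_one, hG]; exact Ideal.subset_span hg
    exact ⟨hgI, h g hg hgI⟩
  | zero => exact ⟨zero_mem _, by rw [reesMonomial_eq_zero_iff.2 rfl]; exact zero_mem _⟩
  | add x y _ _ hx hy =>
    obtain ⟨hx, hx'⟩ := hx
    obtain ⟨hy, hy'⟩ := hy
    exact ⟨add_mem hx hy, by rw [reesMonomial_add hx hy]; exact add_mem hx' hy'⟩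
  | smul r x _ hx =>
    obtain ⟨hx, hx'⟩ := hx
    refine ⟨Ideal.mul_mem_left _ r hx, ?_⟩
    have := reesMonomial_smul r hx
    rw [Algebra.smul_def] at this
    exact this ▸ p.mul_mem_left _ hx'

/-- An ideal of the Rees algebra that contains `a t` for all `a` in a generating set of `I`
contains all elements `a t ^ d` with `d > 0`. -/
theorem reesMonomial_mem_of_span {p : Ideal (reesAlgebra I)} {G : Set R} (hG : I = Ideal.span G)
    (h : ∀ g ∈ G, ∀ hg : g ∈ I ^ 1, reesMonomial I 1 g hg ∈ p) (d : ℕ) (a : R)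
    (ha : a ∈ I ^ (d + 1)) : reesMonomial I (d + 1) a ha ∈ p := by
  have ha' : a ∈ I ^ d * I ^ 1 := by rwa [← pow_add]
  suffices ∃ ha : a ∈ I ^ (d + 1), reesMonomial I (d + 1) a ha ∈ p from this.2
  clear ha
  induction ha' using Submodule.mul_induction_on' with
  | mem_mul_mem x hx y hy =>
    refine ⟨pow_add I d 1 ▸ Ideal.mul_mem_mul hx hy, ?_⟩
    rw [← reesMonomial_mul hx hy]
    exact p.mul_mem_left _ (reesMonomial_one_mem_of_span hG h y hy)
  | add x _ y _ hx hy =>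
    obtain ⟨hx, hx'⟩ := hx
    obtain ⟨hy, hy'⟩ := hy
    exact ⟨add_mem hx hy, by rw [reesMonomial_add hx hy]; exact add_mem hx' hy'⟩

/-- Used by contradiction: a point of `Proj` does not contain the irrelevant ideal, so some `g t`
with `g ∈ G` does not vanish there. -/
theorem irrelevant_le_of_span {p : Ideal (reesAlgebra I)} {G : Set R} (hG : I = Ideal.span G)
    (h : ∀ g ∈ G, ∀ hg : g ∈ I ^ 1, reesMonomial I 1 g hg ∈ p) :
    (HomogeneousIdeal.irrelevant (reesGrading I)).toIdeal ≤ p := by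
  classical
  intro z hz
  rw [← DirectSum.sum_support_decompose (reesGrading I) z]
  refine Ideal.sum_mem _ fun d _ => ?_
  rcases d with _ | d
  · have hz0 : ((DirectSum.decompose (reesGrading I) z) 0 : reesAlgebra I) = 0 := hz
    rw [hz0]
    exact zero_mem _
  · obtain ⟨a, ha, h'⟩ :=
      exists_eq_reesMonomial (DirectSum.decompose (reesGrading I) z (d + 1)).2
    rw [h']
    exact reesMonomial_mem_of_span hG h d a ha

end Rees

/-! ### Charts as subrings of a localization -/

section Chart

variable {R : Type u} [CommRing R] (I : Ideal R)

/-- The coordinate ring of the chart of the blowup of `Spec R` in `I` that belongs to `f ∈ I`. -/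
abbrev BlowupChart (f : R) (hf : f ∈ I ^ 1) : Type u :=
  Away (reesGrading I) (reesMonomial I 1 f hf)

/-- The structure map of a chart of the blowup. -/
def blowupChartMap (f : R) (hf : f ∈ I ^ 1) : R →+* BlowupChart I f hf :=
  (fromZeroRingHom (reesGrading I) _).comp (algebraMap R (reesGrading I 0))

variable (f : R) (L : Type u) [CommRing L] [Algebra R L] [IsLocalization.Away f L]

/-- Evaluation of elements of the Rees algebra at `t = f⁻¹`. -/
def reesEval : reesAlgebra I →ₐ[R] L :=
  (Polynomial.aeval (IsLocalization.Away.invSelf (S := L) f)).comp (reesAlgebra I).val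

variable {I}

theorem reesEval_reesMonomial_mul {d : ℕ} {a : R} (ha : a ∈ I ^ d) :
    reesEval I f L (reesMonomial I d a ha) * algebraMap R L f ^ d = algebraMap R L a := by
  change Polynomial.aeval _ (Polynomial.monomial d a) * _ = _
  rw [Polynomial.aeval_monomial, mul_assoc, ← mul_pow, mul_comm _ (algebraMap R L f),
    IsLocalization.Away.mul_invSelf, one_pow, mul_one]

theorem reesEval_self (hf : f ∈ I ^ 1) : reesEval I f L (reesMonomial I 1 f hf) = 1 := by
  have := reesEval_reesMonomial_mul f L hf
  rw [pow_one] at this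
  exact (IsLocalization.Away.algebraMap_isUnit (S := L) f).mul_right_cancel
    (this.trans (one_mul _).symm)

/-- The embedding of a chart of the blowup into the localization at the exceptional divisor. -/
def blowupChartToLocalization (hf : f ∈ I ^ 1) : BlowupChart I f hf →+* L :=
  (IsLocalization.Away.lift (S := Localization.Away (reesMonomial I 1 f hf))
    (reesMonomial I 1 f hf) (g := (reesEval I f L : reesAlgebra I →+* L)) (by
      rw [RingHom.coe_coe, reesEval_self]; exact isUnit_one)).comp
    (algebraMap (BlowupChart I f hf) (Localization.Away (reesMonomial I 1 f hf)))

theorem blowupChartToLocalization_mk (hf : f ∈ I ^ 1) (n : ℕ) (x : reesAlgebra I)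
    (hx : x ∈ reesGrading I (n • 1)) :
    blowupChartToLocalization f L hf (Away.mk (reesGrading I) (reesMonomial_mem 1 f hf) n x hx) =
      reesEval I f L x := by
  rw [blowupChartToLocalization, RingHom.comp_apply, HomogeneousLocalization.algebraMap_apply, Away.val_mk,
    Localization.mk_eq_mk', IsLocalization.Away.lift, IsLocalization.lift_mk'_spec]
  simp [reesEval_self]

theorem blowupChartToLocalization_comp (hf : f ∈ I ^ 1) :
    (blowupChartToLocalization f L hf).comp (blowupChartMap I f hf) = algebraMap R L := by
  ext r
  have hr : algebraMap R (reesAlgebra I) r ∈ reesGrading I (0 • 1) := by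
    rw [zero_smul]; exact (algebraMap R (reesGrading I 0) r).2
  have : blowupChartMap I f hf r = Away.mk (reesGrading I) (reesMonomial_mem 1 f hf) 0
      (algebraMap R (reesAlgebra I) r) hr := by
    rw [ext_iff_val, Away.val_mk]
    change Localization.mk _ _ = _
    congr 1
  rw [RingHom.comp_apply, this, blowupChartToLocalization_mk, AlgHom.commutes]

/-- If `a / f ^ n` vanishes in `L`, then `f ^ m * a = 0` for some `m`. Hence `(f t) ^ m` kills `a t
^ n`, which is already zero in the chart. So `f` may be a zero divisor. -/
theorem blowupChartToLocalization_injective (hf : f ∈ I ^ 1) :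
    Function.Injective (blowupChartToLocalization f L hf) := by
  rw [injective_iff_map_eq_zero]
  intro z hz
  obtain ⟨n, x, hx, rfl⟩ := Away.mk_surjective (reesGrading I) (reesMonomial_mem 1 f hf) z
  rw [blowupChartToLocalization_mk] at hz
  obtain ⟨a, ha, rfl⟩ := exists_eq_reesMonomial hx
  have h0 := reesEval_reesMonomial_mul f L ha
  rw [hz, zero_mul, eq_comm, IsLocalization.map_eq_zero_iff (Submonoid.powers f)] at h0
  obtain ⟨⟨_, m, rfl⟩, hm⟩ := h0
  rw [ext_iff_val, Away.val_mk, val_zero, Localization.mk_eq_mk', IsLocalization.mk'_eq_zero_iff]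
  refine ⟨⟨_, m, rfl⟩, ?_⟩
  change reesMonomial I 1 f hf ^ m * _ = 0
  rw [reesMonomial_one_pow, reesMonomial_mul, reesMonomial_eq_zero_iff]
  exact hm

/-- This reduces comparing charts to arithmetic with fractions `a / f ^ n`. -/
theorem mem_range_blowupChartToLocalization_iff (hf : f ∈ I ^ 1) (y : L) :
    y ∈ Set.range (blowupChartToLocalization f L hf) ↔
      ∃ n, ∃ a ∈ I ^ n, y * algebraMap R L f ^ n = algebraMap R L a := by
  constructor
  · rintro ⟨z, rfl⟩
    obtain ⟨n, x, hx, rfl⟩ := Away.mk_surjective (reesGrading I) (reesMonomial_mem 1 f hf) z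
    rw [blowupChartToLocalization_mk]
    obtain ⟨a, ha, rfl⟩ := exists_eq_reesMonomial hx
    exact ⟨_, a, ha, reesEval_reesMonomial_mul f L ha⟩
  · rintro ⟨n, a, ha, h⟩
    refine ⟨Away.mk (reesGrading I) (reesMonomial_mem 1 f hf) n (reesMonomial I n a ha)
      (by rw [smul_eq_mul, mul_one]; exact reesMonomial_mem n a ha), ?_⟩
    rw [blowupChartToLocalization_mk]
    rw [← reesEval_reesMonomial_mul f L ha] at h
    exact (((IsLocalization.Away.algebraMap_isUnit (S := L) f).pow n).mul_right_cancel h).symm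

/-- Two rings that embed into a third one with the same image are isomorphic over it. -/
theorem exists_ringEquiv_of_range_eq {A B L : Type*} [CommRing A] [CommRing B] [CommRing L]
    {φ : A →+* L} {ψ : B →+* L} (hφ : Function.Injective φ) (hψ : Function.Injective ψ)
    (h : Set.range φ = Set.range ψ) : ∃ e : A ≃+* B, ∀ a, ψ (e a) = φ a := by
  have h' : ∀ a, ∃ b, ψ b = φ a := fun a => h.le (Set.mem_range_self a)
  choose e he using h'
  let e' : A →+* B :=
    { toFun := e
      map_one' := hψ (by simp [he])
      map_zero' := hψ (by simp [he])
      map_mul' := fun x y => hψ (by simp [he])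
      map_add' := fun x y => hψ (by simp [he]) }
  refine ⟨RingEquiv.ofBijective e' ⟨fun x y hxy => hφ ?_, fun b => ?_⟩, he⟩
  · rw [← he, ← he]
    exact congrArg ψ hxy
  · obtain ⟨a, ha⟩ : ψ b ∈ Set.range φ := h.ge (Set.mem_range_self b)
    exact ⟨a, hψ ((he a).trans ha)⟩

/-- If the images of two charts in a common localization agree, then the charts are isomorphic
over `R`. -/
theorem exists_blowupChart_equiv {J : Ideal R} {f g : R} (hf : f ∈ I ^ 1) (hg : g ∈ J ^ 1)
    (L : Type u) [CommRing L] [Algebra R L] [IsLocalization.Away f L] [IsLocalization.Away g L]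
    (h : Set.range (blowupChartToLocalization f L hf) =
      Set.range (blowupChartToLocalization g L hg)) :
    ∃ e : BlowupChart I f hf ≃+* BlowupChart J g hg,
      (e : BlowupChart I f hf →+* BlowupChart J g hg).comp (blowupChartMap I f hf) =
        blowupChartMap J g hg := by
  obtain ⟨e, he⟩ := exists_ringEquiv_of_range_eq (blowupChartToLocalization_injective f L hf)
    (blowupChartToLocalization_injective g L hg) h
  refine ⟨e, RingHom.ext fun r => blowupChartToLocalization_injective g L hg ((he _).trans ?_)⟩
  exact (RingHom.congr_fun (blowupChartToLocalization_comp f L hf) r).trans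
    (RingHom.congr_fun (blowupChartToLocalization_comp g L hg) r).symm

end Chart

/-! ### Smoothness on charts -/

section Smooth

variable {R : Type u} [CommRing R] {I : Ideal R}

/-- Smoothness of a blowup is checked on charts. Charts cover the blowup if `I` is generated by elements some
powers of which are multiples, in the Rees algebra, of the elements defining the charts. -/
theorem smooth_blowupMap_comp_iff {k : Type u} [CommRing k] (φ : k →+* R) {ι : Type u} (f : ι → R)
    (hf : ∀ i, f i ∈ I ^ 1) {G : Set R} (hG : I = Ideal.span G)
    (hfG : ∀ g ∈ G, ∃ i m, ∃ r ∈ I ^ m, g ^ (m + 1) = f i * r) :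
    Smooth (blowupMap I ≫ Spec.map (CommRingCat.ofHom φ)) ↔
      ∀ i, ((blowupChartMap I (f i) (hf i)).comp φ).Smooth := by
  have hcover : ⨆ i, Proj.basicOpen (reesGrading I) (reesMonomial I 1 (f i) (hf i)) = ⊤ := by
    refine top_le_iff.mp fun x _ => TopologicalSpace.Opens.mem_iSup.mpr ?_
    by_contra! H
    simp only [Proj.mem_basicOpen, not_not] at H
    -- If all `f i t` lie in the prime `x`, so does `(g t) ^ (m + 1) = (f i t) * (r t ^ m)`, hence
    -- `g t`.
    refine x.not_irrelevant_le (irrelevant_le_of_span hG fun g hg hgI => ?_)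
    obtain ⟨i, m, r, hr, h⟩ := hfG g hg
    have hp : x.asHomogeneousIdeal.toIdeal.IsPrime := x.isPrime
    refine hp.mem_of_pow_mem (m + 1) ?_
    have := x.asHomogeneousIdeal.toIdeal.mul_mem_right (reesMonomial I m r hr) (H i)
    rw [reesMonomial_mul] at this
    rw [reesMonomial_one_pow]
    convert! this using 1
    refine Subtype.ext ?_
    simp only [reesMonomial, h, add_comm]
  let 𝒰 : (Proj (reesGrading I)).AffineOpenCover :=
    { I₀ := ι
      X := fun i => .of (BlowupChart I (f i) (hf i))
      f := fun i => Proj.awayι (reesGrading I) _ (reesMonomial_mem 1 (f i) (hf i)) one_pos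
      idx := fun x => (TopologicalSpace.Opens.mem_iSup.mp (hcover.ge (Set.mem_univ x))).choose
      covers := fun x => by
        change x ∈ (Proj.awayι (reesGrading I) _ _ _).opensRange
        rw [Proj.opensRange_awayι]
        exact (TopologicalSpace.Opens.mem_iSup.mp (hcover.ge (Set.mem_univ x))).choose_spec }
  have hloc : IsZariskiLocalAtSource @Smooth.{u} :=
    HasRingHomProperty.instIsZariskiLocalAtSource (Q := RingHom.Smooth)
  refine (IsZariskiLocalAtSource.iff_of_openCover (P := @Smooth.{u})
    (X := Proj (reesGrading I)) 𝒰.openCover).trans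
    (forall_congr' fun i => ?_)
  have : 𝒰.openCover.f i ≫ blowupMap I ≫ Spec.map (CommRingCat.ofHom φ) =
      Spec.map (CommRingCat.ofHom ((blowupChartMap I (f i) (hf i)).comp φ)) := by
    change Proj.awayι (reesGrading I) _ (reesMonomial_mem 1 (f i) (hf i)) one_pos ≫
      (Proj.toSpecZero (reesGrading I) ≫ _) ≫ _ = _
    rw [Category.assoc, Proj.awayι_toSpecZero_assoc, ← Spec.map_comp, ← Spec.map_comp]
    rfl
  exact (iff_of_eq (congrArg (fun g => Smooth g) this)).trans
    (HasRingHomProperty.Spec_iff (P := @Smooth.{u}))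

theorem smooth_comp_iff_of_equiv {k A B : Type u} [CommRing k] [CommRing A] [CommRing B]
    {a : k →+* A} {b : k →+* B} (e : A ≃+* B) (h : (e : A →+* B).comp a = b) :
    a.Smooth ↔ b.Smooth := by
  subst h
  refine ⟨fun ha => RingHom.Smooth.respectsIso.1 a e ha, fun hb => ?_⟩
  convert! RingHom.Smooth.respectsIso.1 _ e.symm hb using 1
  ext x
  exact (e.symm_apply_apply _).symm

end Smooth

/-! ### Powers of factors of the center -/

section Products

variable {R : Type u} [CommRing R]

/-- Expand the fractions: `a / (xy)^n = a y^n / (xy²)^n`, and `b / (xy²)^n = b x^n / (xy)^(2n)`,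
where `b x^n ∈ (JI²)^n J^n = (JI)^(2n)`. -/
theorem range_blowupChartToLocalization_mul_sq {J I : Ideal R} {x y : R} (hx : x ∈ J) (hy : y ∈ I)
    (h₁ : x * y ∈ (J * I) ^ 1) (h₂ : x * y ^ 2 ∈ (J * I ^ 2) ^ 1) (L : Type u) [CommRing L]
    [Algebra R L] [IsLocalization.Away (x * y) L] [IsLocalization.Away (x * y ^ 2) L] :
    Set.range (blowupChartToLocalization (x * y) L h₁) =
      Set.range (blowupChartToLocalization (x * y ^ 2) L h₂) := by
  ext z
  rw [mem_range_blowupChartToLocalization_iff, mem_range_blowupChartToLocalization_iff]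
  constructor
  · rintro ⟨n, a, ha, h⟩
    refine ⟨n, a * y ^ n, ?_, ?_⟩
    · rw [pow_two, ← mul_assoc, mul_pow (J * I)]
      exact Ideal.mul_mem_mul ha (Ideal.pow_mem_pow hy n)
    · rw [map_mul _ a, ← h]
      simp only [map_mul, map_pow]
      ring
  · rintro ⟨n, a, ha, h⟩
    refine ⟨2 * n, a * x ^ n, ?_, ?_⟩
    · have : (J * I) ^ (2 * n) = (J * I ^ 2) ^ n * J ^ n := by ring
      rw [this]
      exact Ideal.mul_mem_mul ha (Ideal.pow_mem_pow hx n)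
    · rw [map_mul _ a, ← h]
      simp only [map_mul, map_pow]
      ring

/-- Squaring a factor of the center of a blowup does not affect the smoothness of the blowup. -/
theorem smooth_blowupMap_mul_sq_iff {k : Type u} [CommRing k] (φ : k →+* R) (J I : Ideal R) :
    Smooth (blowupMap (J * I ^ 2) ≫ Spec.map (CommRingCat.ofHom φ)) ↔
      Smooth (blowupMap (J * I) ≫ Spec.map (CommRingCat.ofHom φ)) := by
  have h₁ : ∀ i : J × I, (i.1 * i.2 : R) ∈ (J * I) ^ 1 := fun i => by
    rw [pow_one]; exact Ideal.mul_mem_mul i.1.2 i.2.2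
  have h₂ : ∀ i : J × I, (i.1 * i.2 ^ 2 : R) ∈ (J * I ^ 2) ^ 1 := fun i => by
    rw [pow_one]; exact Ideal.mul_mem_mul i.1.2 (Ideal.pow_mem_pow i.2.2 2)
  rw [smooth_blowupMap_comp_iff φ (fun i : J × I => (i.1 * i.2 ^ 2 : R)) h₂
      (G := {g | ∃ x ∈ J, ∃ y ∈ I, ∃ z ∈ I, g = x * (y * z)}) ?_ ?_,
    smooth_blowupMap_comp_iff φ (fun i : J × I => (i.1 * i.2 : R)) h₁
      (G := {g | ∃ x ∈ J, ∃ y ∈ I, g = x * y}) ?_ ?_]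
  · refine forall_congr' fun ⟨⟨x, hx⟩, ⟨y, hy⟩⟩ => ?_
    let L := Localization.Away (x * y)
    -- `y` divides `x * y`, so it is already a unit in `L`.
    have : IsLocalization.Away (x * y ^ 2) L := by
      rw [pow_two, ← mul_assoc]
      refine IsLocalization.Away.mul_of_isUnit (x * y) y ?_
      exact IsLocalization.Away.isUnit_of_dvd (x * y) (dvd_mul_left y x)
    obtain ⟨e, he⟩ := exists_blowupChart_equiv (h₁ ⟨⟨x, hx⟩, ⟨y, hy⟩⟩) (h₂ ⟨⟨x, hx⟩, ⟨y, hy⟩⟩) L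
      (range_blowupChartToLocalization_mul_sq hx hy _ _ L)
    refine (smooth_comp_iff_of_equiv e ?_).symm
    rw [← RingHom.comp_assoc, he]
  · refine le_antisymm (Ideal.mul_le.2 fun x hx y hy => Ideal.subset_span ⟨x, hx, y, hy, rfl⟩) ?_
    rw [Ideal.span_le]
    rintro _ ⟨x, hx, y, hy, rfl⟩
    exact Ideal.mul_mem_mul hx hy
  · rintro _ ⟨x, hx, y, hy, rfl⟩
    exact ⟨⟨⟨x, hx⟩, ⟨y, hy⟩⟩, 0, 1, by simp, by simp⟩
  · refine le_antisymm (Ideal.mul_le.2 fun x hx w hw => ?_) ?_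
    · rw [pow_two] at hw
      induction hw using Submodule.mul_induction_on' with
      | mem_mul_mem y hy z hz => exact Ideal.subset_span ⟨x, hx, y, hy, z, hz, rfl⟩
      | add a _ b _ ha hb => rw [mul_add]; exact add_mem ha hb
    · rw [Ideal.span_le]
      rintro _ ⟨x, hx, y, hy, z, hz, rfl⟩
      rw [pow_two]
      exact Ideal.mul_mem_mul hx (Ideal.mul_mem_mul hy hz)
  · rintro _ ⟨x, hx, y, hy, z, hz, rfl⟩
    -- The mixed generators need no charts of their own, since `(xyz)² = (xy²)(xz²)`.
    refine ⟨⟨⟨x, hx⟩, ⟨y, hy⟩⟩, 1, x * z ^ 2, ?_, by ring⟩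
    rw [pow_one]
    exact Ideal.mul_mem_mul hx (Ideal.pow_mem_pow hz 2)

theorem smooth_blowupMap_mul_pow_iff {k : Type u} [CommRing k] (φ : k →+* R) (J I : Ideal R)
    (n : ℕ) :
    Smooth (blowupMap (J * I ^ (n + 1)) ≫ Spec.map (CommRingCat.ofHom φ)) ↔
      Smooth (blowupMap (J * I) ≫ Spec.map (CommRingCat.ofHom φ)) := by
  induction n with
  | zero => rw [zero_add, pow_one]
  | succ n ih =>
    rw [← ih, show J * I ^ (n + 1 + 1) = J * I ^ n * I ^ 2 by ring,
      show J * I ^ (n + 1) = J * I ^ n * I by ring, smooth_blowupMap_mul_sq_iff]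

/-- The extra factor `J` varies in the induction: it absorbs `I i ^ α i` while the other exponents
are removed. -/
theorem smooth_blowupMap_mul_prod_pow_iff {k : Type u} [CommRing k] (φ : k →+* R) {ι : Type*}
    (s : Finset ι) (I : ι → Ideal R) (α : ι → ℕ) (hα : ∀ i ∈ s, 0 < α i) (J : Ideal R) :
    Smooth (blowupMap (J * ∏ i ∈ s, I i ^ α i) ≫ Spec.map (CommRingCat.ofHom φ)) ↔
      Smooth (blowupMap (J * ∏ i ∈ s, I i) ≫ Spec.map (CommRingCat.ofHom φ)) := by
  classical
  induction s using Finset.induction_on generalizing J with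
  | empty => simp
  | insert i s hi ih =>
    obtain ⟨m, hm⟩ := Nat.exists_eq_succ_of_ne_zero (hα i (Finset.mem_insert_self i s)).ne'
    rw [Finset.prod_insert hi, Finset.prod_insert hi, ← mul_assoc, ← mul_assoc,
      ih fun j hj => hα j (Finset.mem_insert_of_mem hj), hm, Nat.succ_eq_add_one,
      mul_right_comm, smooth_blowupMap_mul_pow_iff, mul_right_comm]

end Products

end TameMonomial

end

theorem mainTheorem11 {K : Type*} [Field K] (n : ℕ) :
    (∀ (k : ℕ) (I : Fin k → Ideal (MvPolynomial (Fin n) K)) (α : Fin k → ℕ),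
      (∀ i, TameMonomial.IsMonomialIdeal (I i)) → (∀ i, 0 < α i) →
        (TameMonomial.IsTame (∏ i, I i) ↔ TameMonomial.IsTame (∏ i, I i ^ α i))) ∧
    (∀ I : Ideal (MvPolynomial (Fin n) K), TameMonomial.IsMonomialIdeal I →
      (TameMonomial.IsTame I ↔ TameMonomial.IsTame (I ^ 2))) := by
  refine ⟨fun k I α _ hα => ?_, fun I _ => ?_⟩
  · have := TameMonomial.smooth_blowupMap_mul_prod_pow_iff (algebraMap K (MvPolynomial (Fin n) K))
      Finset.univ I α (fun i _ => hα i) 1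
    rw [one_mul, one_mul] at this
    exact this.symm
  · have := TameMonomial.smooth_blowupMap_mul_sq_iff (algebraMap K (MvPolynomial (Fin n) K)) 1 I
    rw [one_mul, one_mul] at this
    exact this.symm
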